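/- Let $n\ge 4$ be an integer and let $b,c\in\mathbb{R}$ with $b,c\notin\{0,-1,\dots,-n+1\}$. Consider the polynomial $${}_2F_1(-n,b;c;z)=\sum_{k=0}^{n}\frac{(-n)_k\,(b)_k}{(c)_k}\,\frac{z^k}{k!},\qquad (\alpha)_0=1,\quad (\alpha)_k=\alpha(\alpha+1)\cdots(\alpha+k-1)\quad (k\ge 1).$$ All zeros of ${}_2F_1(-n,b;c;z)$ in $\mathbb{C}$ are real and simple if and only if $(c,b)\in\mathcal{R}_1\cup\mathcal{R}_2\cup\mathcal{R}_3\cup\mathcal{R}_4$, where $$\begin{aligned} \mathcal{R}_1&=\{(c,b)\in\mathbb{R}^2:\ c+n-2<b<2-n\},\\ \mathcal{R}_2&=\{(c,b)\in\mathbb{R}^2:\ c>-1,\ b<2-n\},\\ \mathcal{R}_3&=\{(c,b)\in\mathbb{R}^2:\ c>-1,\ b>n-2,\ b>c+n-2\},\\ \mathcal{R}_4&=\{(c,b)\in\mathbb{R}^2:\ -1<c<0,\ c+n-2<b\le n-2\}. \end{aligned}$$ -/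

import Mathlib

open Polynomial

noncomputable section

/-- The hypergeometric polynomial `₂F₁(-n, b; c; z) = ∑_{k=0}^{n} (-n)_k (b)_k / (c)_k * z^k / k!`
as a polynomial in `z` with real coefficients. The coefficients are those of Mathlib's
`ordinaryHypergeometricSeries`. For `k > n` the factor `(-n)_k` vanishes, and for `k ≤ n` the
denominators `(c)_k` do not vanish as long as `c ≠ 0, -1, …, -n+1`. -/
def hypergeometricPolynomial (n : ℕ) (b c : ℝ) : ℝ[X] :=
  ∑ k ∈ Finset.range (n + 1), C (ordinaryHypergeometricCoefficient (-(n : ℝ)) b c k) * X ^ k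

/-- The values of the polynomial at complex points are those of the Gaussian hypergeometric
function `₂F₁` (the terminating series). -/
theorem aeval_hypergeometricPolynomial (n : ℕ) (b c : ℝ) (z : ℂ) :
    aeval z (hypergeometricPolynomial n b c) = ordinaryHypergeometric (-(n : ℝ)) b c z := by
  rw [ordinaryHypergeometric_eq_tsum, hypergeometricPolynomial]
  dsimp only
  rw [tsum_eq_sum (s := Finset.range (n + 1))]
  · simp [map_sum, Algebra.smul_def]
  · intro k hk
    have hk' : n < k := by simpa [Nat.lt_succ_iff] using hk
    rw [ascPochhammer_eval_neg_coe_nat_of_lt hk']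
    simp

/-- All complex zeros of the real polynomial `p` are real and simple. -/
def HasOnlyRealSimpleZeros (p : ℝ[X]) : Prop :=
  ∀ z : ℂ, (p.map (algebraMap ℝ ℂ)).IsRoot z →
    z.im = 0 ∧ (p.map (algebraMap ℝ ℂ)).rootMultiplicity z = 1

/-- `R₁ = {(c, b) : c + n - 2 < b < 2 - n}`. -/
def regionR₁ (n : ℕ) : Set (ℝ × ℝ) :=
  {p | p.1 + n - 2 < p.2 ∧ p.2 < 2 - n}

/-- `R₂ = {(c, b) : c > -1, b < 2 - n}`. -/
def regionR₂ (n : ℕ) : Set (ℝ × ℝ) :=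
  {p | p.1 > -1 ∧ p.2 < 2 - n}

/-- `R₃ = {(c, b) : c > -1, b > n - 2, b > c + n - 2}`. -/
def regionR₃ (n : ℕ) : Set (ℝ × ℝ) :=
  {p | p.1 > -1 ∧ p.2 > n - 2 ∧ p.2 > p.1 + n - 2}

/-- `R₄ = {(c, b) : -1 < c < 0, c + n - 2 < b ≤ n - 2}`; the upper edge `b = n - 2`
belongs to the region. -/
def regionR₄ (n : ℕ) : Set (ℝ × ℝ) :=
  {p | -1 < p.1 ∧ p.1 < 0 ∧ p.1 + n - 2 < p.2 ∧ p.2 ≤ n - 2}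

end

/-!
Write `α = c - 1`, `β = b - c - n`, `γ = -b - n` for the parameters attached to the singular points
`0`, `1`, `∞` of the hypergeometric equation; they satisfy `α + β + γ = -2 n - 1`. The union of the
four regions says that at least two of `α`, `β`, `γ` exceed `-2` (`mem_regions_iff`).

**Necessity.** Regard the polynomial as a real binary form of degree `n`. A form all of whose zeros
on the real projective line are real and simple keeps this property under every polar derivative
with respect to a real point, by Rolle's theorem. The polar derivatives at `∞`, `1` and `0` turn a
hypergeometric polynomial into one of degree `n - 1`, raising by one the two parameters attached to
the other two points. After `n - 2` such steps one reaches a quadratic form, whose discriminant is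
positive. This gives `(α + n - s) * (β + n - r) * (γ + n - q) < 0` whenever `q + r + s = n - 2`
(`IsRealSimpleForm.mul_pos`). An argument with integer parts, which needs `4 ≤ n`, then yields that
two of the parameters exceed `-2` (`two_gt_of_forall_mul_neg`).

**Sufficiency.** Suppose that `α, β > -2`. The derivative has parameters `α + 1, β + 1 > -1`, and
its `n - 1` zeros are simple and lie in `(0, 1)`
(`IsHypergeometricSolution.natDegree_le_card_filter`). At such a critical point `x` the differential
equation reads `x (1 - x) p'' = -n b p` with `b > 0`, so that `p p'' < 0`: all local maxima are
positive, all local minima negative, and `p` has `n` real zeros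
(`card_roots_derivative_lt_card_roots`). The other two cases reduce to this one by the
substitutions `x ↦ 1 / x` and `x ↦ 1 - x`, which permute the singular points.
-/

/-! ### A sign condition on three numbers with a fixed sum -/

/-- Three reals of sum `n - 1` such that, whenever naturals of sum `n - 2` are subtracted from them,
the product of the differences is negative. Since the differences always have sum `1`, exactly one
of them is negative, and this forces two of the three numbers to exceed `n - 2`. -/
lemma two_gt_of_forall_mul_neg {n : ℕ} (hn : 4 ≤ n) {A B G : ℝ} (hsum : A + B + G = n - 1)
    (h : ∀ q r p : ℕ, q + r + p = n - 2 → (A - q) * (B - r) * (G - p) < 0) :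
    ((n : ℝ) - 2 < A ∧ (n : ℝ) - 2 < B) ∨ ((n : ℝ) - 2 < A ∧ (n : ℝ) - 2 < G) ∨
      ((n : ℝ) - 2 < B ∧ (n : ℝ) - 2 < G) := by
  have hn2 : ((n - 2 : ℕ) : ℝ) = n - 2 := by
    rw [Nat.cast_sub (by omega)]
    norm_num
  -- If one of the numbers is negative, subtracting all of `n - 2` from either of the others
  -- must leave a positive number.
  have key : ∀ {x y z : ℝ}, x < 0 → x + y + z = n - 1 → x * (y - (n - 2)) * z < 0 →
      (n : ℝ) - 2 < y := by
    intro x y z hx hs hxyz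
    by_contra! hy
    have hz : 0 < z := by linarith
    have : 0 ≤ x * (y - (n - 2)) := mul_nonneg_of_nonpos_of_nonpos hx.le (by linarith)
    linarith [mul_nonneg this hz.le]
  rcases lt_or_ge A 0 with hA | hA
  · have h1 := h 0 (n - 2) 0 (by omega)
    have h2 := h 0 0 (n - 2) (by omega)
    rw [hn2] at h1 h2
    push_cast at h1 h2
    exact Or.inr <| Or.inr ⟨key (x := A) (z := G) hA (by linarith) (by linarith),
      key (x := A) (z := B) hA (by linarith) (by linarith)⟩
  rcases lt_or_ge B 0 with hB | hB
  · have h1 := h (n - 2) 0 0 (by omega)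
    have h2 := h 0 0 (n - 2) (by omega)
    rw [hn2] at h1 h2
    push_cast at h1 h2
    exact Or.inr <| Or.inl ⟨key (x := B) (z := G) hB (by linarith) (by linarith),
      key (x := B) (z := A) hB (by linarith) (by linarith)⟩
  rcases lt_or_ge G 0 with hG | hG
  · have h1 := h (n - 2) 0 0 (by omega)
    have h2 := h 0 (n - 2) 0 (by omega)
    rw [hn2] at h1 h2
    push_cast at h1 h2
    exact Or.inl ⟨key (x := G) (z := B) hG (by linarith) (by linarith),
      key (x := G) (z := A) hG (by linarith) (by linarith)⟩
  exfalso
  obtain ⟨hx, hx'⟩ := And.intro (Nat.floor_le hA) (Nat.lt_floor_add_one A)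
  obtain ⟨hy, hy'⟩ := And.intro (Nat.floor_le hB) (Nat.lt_floor_add_one B)
  obtain ⟨hz, hz'⟩ := And.intro (Nat.floor_le hG) (Nat.lt_floor_add_one G)
  generalize ⌊A⌋₊ = x at *
  generalize ⌊B⌋₊ = y at *
  generalize ⌊G⌋₊ = z at *
  have hlow : n < x + y + z + 4 := by
    have : (n : ℝ) < ((x + y + z + 4 : ℕ) : ℝ) := by
      push_cast
      linarith
    exact_mod_cast this
  rcases le_or_gt (n - 2) (x + y + z) with hle | hlt
  · -- All differences can be made nonnegative.
    obtain ⟨q, r, p, hq, hr, hp, hs⟩ : ∃ q r p : ℕ, q ≤ x ∧ r ≤ y ∧ p ≤ z ∧ q + r + p = n - 2 :=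
      ⟨min x (n - 2), min y (n - 2 - min x (n - 2)),
        n - 2 - min x (n - 2) - min y (n - 2 - min x (n - 2)), by omega, by omega, by omega,
        by omega⟩
    have hq' : (q : ℝ) ≤ x := by exact_mod_cast hq
    have hr' : (r : ℝ) ≤ y := by exact_mod_cast hr
    have hp' : (p : ℝ) ≤ z := by exact_mod_cast hp
    have := h q r p hs
    have : 0 ≤ (A - q) * (B - r) * (G - p) :=
      mul_nonneg (mul_nonneg (by linarith) (by linarith)) (by linarith)
    linarith
  · -- The integer parts have sum `n - 3 ≥ 1`, so two differences can be made negative.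
    have hcases : 1 ≤ x ∨ 1 ≤ y ∨ 1 ≤ z := by omega
    rcases hcases with h1 | h1 | h1
    · have := h (x - 1) (y + 1) (z + 1) (by omega)
      push_cast [Nat.cast_sub h1] at this
      have : 0 < (A - (x - 1)) * ((B - (y + 1)) * (G - (z + 1))) :=
        mul_pos (by linarith) (mul_pos_of_neg_of_neg (by linarith) (by linarith))
      linarith
    · have := h (x + 1) (y - 1) (z + 1) (by omega)
      push_cast [Nat.cast_sub h1] at this
      have : 0 < (B - (y - 1)) * ((A - (x + 1)) * (G - (z + 1))) :=
        mul_pos (by linarith) (mul_pos_of_neg_of_neg (by linarith) (by linarith))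
      linarith
    · have := h (x + 1) (y + 1) (z - 1) (by omega)
      push_cast [Nat.cast_sub h1] at this
      have : 0 < (G - (z - 1)) * ((A - (x + 1)) * (B - (y + 1))) :=
        mul_pos (by linarith) (mul_pos_of_neg_of_neg (by linarith) (by linarith))
      linarith

/-! ### Real binary forms with simple real zeros -/

/-- The binary form of degree `m` with dehomogenization `p` has `m` distinct zeros on the real
projective line; the point at infinity is a zero when the coefficient of `X ^ m` vanishes. -/
def IsRealSimpleForm (m : ℕ) (p : ℝ[X]) : Prop :=
  p ≠ 0 ∧ p.natDegree ≤ m ∧ m ≤ p.roots.toFinset.card + if p.coeff m = 0 then 1 else 0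

lemma isRealSimpleForm_natDegree_iff {p : ℝ[X]} (hp : p ≠ 0) :
    IsRealSimpleForm p.natDegree p ↔ p.natDegree ≤ p.roots.toFinset.card := by
  simp [IsRealSimpleForm, hp]

lemma card_roots_toFinset_le_natDegree (p : ℝ[X]) : p.roots.toFinset.card ≤ p.natDegree :=
  (Multiset.toFinset_card_le _).trans (card_roots' p)

lemma coeff_X_mul_derivative (p : ℝ[X]) (k : ℕ) :
    (X * derivative p).coeff k = k * p.coeff k := by
  cases k with
  | zero => simp
  | succ k =>
    rw [coeff_X_mul, coeff_derivative]
    push_cast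
    ring

namespace IsRealSimpleForm

variable {m : ℕ} {p : ℝ[X]}

/-- Rolle's theorem. -/
lemma derivative (hm : 1 ≤ m) (h : IsRealSimpleForm (m + 1) p) :
    IsRealSimpleForm m (derivative p) := by
  obtain ⟨h0, hdeg, hroots⟩ := h
  have hrolle := card_roots_toFinset_le_derivative p
  have hcoeff : (Polynomial.derivative p).coeff m = 0 ↔ p.coeff (m + 1) = 0 := by
    rw [coeff_derivative, mul_eq_zero]
    exact or_iff_left (by positivity)
  refine ⟨fun h => ?_, (natDegree_derivative_le p).trans (by omega), ?_⟩
  · have h1 := card_roots_toFinset_le_natDegree p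
    rw [Polynomial.derivative_eq_zero.1 h] at h1
    have : p.coeff (m + 1) = 0 := hcoeff.1 (by simp [h])
    rw [if_pos this] at hroots
    omega
  · simp only [hcoeff]
    omega

/-- The substitution `x ↦ 1 / x` permutes the zeros on the projective line. -/
lemma reflect (h : IsRealSimpleForm m p) : IsRealSimpleForm m (reflect m p) := by
  obtain ⟨h0, hdeg, hroots⟩ := h
  have hne : Polynomial.reflect m p ≠ 0 := by rwa [Ne, reflect_eq_zero_iff]
  refine ⟨hne, natDegree_reflect_le.trans (by omega), ?_⟩
  have hm0 : (Polynomial.reflect m p).coeff m = p.coeff 0 := by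
    rw [coeff_reflect, revAt_le le_rfl, Nat.sub_self]
  have h0m : (Polynomial.reflect m p).coeff 0 = p.coeff m := by
    rw [coeff_reflect, revAt_le (Nat.zero_le _), Nat.sub_zero]
  have hinv : ∀ x ∈ p.roots.toFinset.erase 0, x⁻¹ ∈ (Polynomial.reflect m p).roots.toFinset := by
    intro x hx
    rw [Finset.mem_erase, Multiset.mem_toFinset, mem_roots h0] at hx
    rw [Multiset.mem_toFinset, mem_roots hne]
    let _ := invertibleOfNonzero hx.1
    have := (eval₂_reflect_eq_zero_iff (RingHom.id ℝ) x m p hdeg).2 hx.2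
    rwa [invOf_eq_inv] at this
  have himage : ((p.roots.toFinset.erase 0).image fun x => x⁻¹) ⊆
      (Polynomial.reflect m p).roots.toFinset.erase 0 := by
    intro y hy
    obtain ⟨x, hx, rfl⟩ := Finset.mem_image.1 hy
    exact Finset.mem_erase.2 ⟨inv_ne_zero (Finset.mem_erase.1 hx).1, hinv x hx⟩
  have hcard := Finset.card_le_card himage
  rw [Finset.card_image_of_injective _ inv_injective] at hcard
  have hzero : ∀ q : ℝ[X], q ≠ 0 →
      (q.roots.toFinset.erase 0).card + (if q.coeff 0 = 0 then 1 else 0) =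
        q.roots.toFinset.card := by
    intro q hq
    have hmem : (0 : ℝ) ∈ q.roots.toFinset ↔ q.coeff 0 = 0 := by
      rw [Multiset.mem_toFinset, mem_roots hq, IsRoot.def, coeff_zero_eq_eval_zero]
    by_cases hq0 : q.coeff 0 = 0
    · rw [if_pos hq0, Finset.card_erase_add_one (hmem.2 hq0)]
    · rw [if_neg hq0, Finset.erase_eq_of_notMem (fun h => hq0 (hmem.1 h)), add_zero]
  have h1 := hzero p h0
  have h2 := hzero _ hne
  rw [h0m] at h2
  rw [hm0]
  omega

/-- Invertible affine substitutions permute the zeros on the projective line. -/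
lemma comp_affine (h : IsRealSimpleForm m p) {u : ℝ} (hu : u ≠ 0) (v : ℝ) :
    IsRealSimpleForm m (p.comp (C u * X + C v)) := by
  obtain ⟨h0, hdeg, hroots⟩ := h
  have hlin : (C u * X + C v).natDegree = 1 := natDegree_linear hu
  have hdeg' : (p.comp (C u * X + C v)).natDegree = p.natDegree := by
    rw [natDegree_comp, hlin, mul_one]
  have hne : p.comp (C u * X + C v) ≠ 0 := by
    rw [Ne, comp_eq_zero_iff]
    rintro (h | ⟨-, h⟩)
    · exact h0 h
    · rw [h, natDegree_C] at hlin
      exact zero_ne_one hlin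
  have hcoeff : (p.comp (C u * X + C v)).coeff m = 0 ↔ p.coeff m = 0 := by
    rcases hdeg.lt_or_eq with hlt | rfl
    · rw [coeff_eq_zero_of_natDegree_lt (hdeg'.trans_lt hlt), coeff_eq_zero_of_natDegree_lt hlt]
    · nth_rw 1 [← hdeg']
      rw [coeff_natDegree, coeff_natDegree, leadingCoeff_eq_zero, leadingCoeff_eq_zero]
      exact iff_of_false hne h0
  refine ⟨hne, hdeg'.trans_le hdeg, hroots.trans ?_⟩
  simp only [hcoeff]
  refine Nat.add_le_add_right ?_ _
  rw [← Finset.card_image_of_injective (f := fun x => u⁻¹ * (x - v)) p.roots.toFinset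
    (fun x y hxy => by simpa [hu] using hxy)]
  refine Finset.card_le_card fun y hy => ?_
  obtain ⟨x, hx, rfl⟩ := Finset.mem_image.1 hy
  rw [Multiset.mem_toFinset, mem_roots h0] at hx
  rw [Multiset.mem_toFinset, mem_roots hne, IsRoot.def, eval_comp]
  simpa [hu] using hx

/-- The polar derivative with respect to the point `0` of the projective line is conjugate to the
ordinary derivative, the one with respect to the point at infinity. -/
lemma polar_zero (hm : 1 ≤ m) (h : IsRealSimpleForm (m + 1) p) :
    IsRealSimpleForm m (C (m + 1 : ℝ) * p - X * Polynomial.derivative p) := by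
  convert (h.reflect.derivative hm).reflect using 1
  ext k
  rw [coeff_reflect, coeff_derivative, coeff_reflect, coeff_sub, coeff_C_mul]
  rw [coeff_X_mul_derivative]
  rcases le_or_gt k m with hk | hk
  · rw [revAt_le hk, revAt_le (by omega), show m + 1 - (m - k + 1) = k by omega,
      Nat.cast_sub hk]
    ring
  · rw [revAt_eq_self_of_lt hk]
    rcases (Nat.succ_le_iff.2 hk).eq_or_lt with rfl | hk'
    · rw [revAt_eq_self_of_lt (by omega),
        coeff_eq_zero_of_natDegree_lt (h.2.1.trans_lt (by omega : m + 1 < m.succ + 1))]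
      push_cast
      ring
    · rw [revAt_eq_self_of_lt (by omega), coeff_eq_zero_of_natDegree_lt (h.2.1.trans_lt hk'),
        coeff_eq_zero_of_natDegree_lt (h.2.1.trans_lt (by omega))]
      ring

/-- The polar derivative with respect to the point `1` of the projective line is the one with
respect to `0`, conjugated by a translation. -/
lemma polar_one (hm : 1 ≤ m) (h : IsRealSimpleForm (m + 1) p) :
    IsRealSimpleForm m (C (m + 1 : ℝ) * p + (1 - X) * Polynomial.derivative p) := by
  convert ((h.comp_affine one_ne_zero 1).polar_zero hm).comp_affine one_ne_zero (-1) using 1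
  have hcomp : (C (1 : ℝ) * X + C 1).comp (C 1 * X + C (-1)) = X := by simp
  simp only [sub_comp, mul_comp, derivative_comp, comp_assoc, hcomp, comp_X, C_comp]
  simp
  ring

/-- The discriminant of a real quadratic form with two distinct zeros is positive. -/
lemma discrim_pos (h : IsRealSimpleForm 2 p) :
    0 < p.coeff 1 ^ 2 - 4 * p.coeff 0 * p.coeff 2 := by
  obtain ⟨h0, hdeg, hroots⟩ := h
  have heval : ∀ x ∈ p.roots.toFinset, p.coeff 0 + p.coeff 1 * x + p.coeff 2 * x ^ 2 = 0 := by
    intro x hx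
    rw [Multiset.mem_toFinset, mem_roots h0, IsRoot.def,
      eval_eq_sum_range' (Nat.lt_succ_of_le hdeg)] at hx
    simpa [Finset.sum_range_succ] using hx
  by_cases h2 : p.coeff 2 = 0
  · rw [if_pos h2] at hroots
    obtain ⟨x, hx⟩ := Finset.card_pos.1 (by omega : 0 < p.roots.toFinset.card)
    have hx' := heval x hx
    rw [h2] at hx' ⊢
    have h1 : p.coeff 1 ≠ 0 := by
      intro h1
      rw [h1] at hx'
      refine h0 (Polynomial.ext fun k => ?_)
      match k with
      | 0 => simpa using hx'
      | 1 => simpa using h1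
      | 2 => simpa using h2
      | k + 3 => exact coeff_eq_zero_of_natDegree_lt (by omega)
    have := pow_pos (abs_pos.2 h1) 2
    rw [sq_abs] at this
    linarith
  · rw [if_neg h2] at hroots
    obtain ⟨x, hx, y, hy, hxy⟩ := Finset.one_lt_card.1 (by omega : 1 < p.roots.toFinset.card)
    have hx' := heval x hx
    have hy' := heval y hy
    have hsum : p.coeff 1 = -p.coeff 2 * (x + y) := by
      refine mul_right_cancel₀ (sub_ne_zero.2 hxy) ?_
      linear_combination hx' - hy'
    have hdisc : p.coeff 1 ^ 2 - 4 * p.coeff 0 * p.coeff 2 = (p.coeff 2 * (x - y)) ^ 2 := by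
      rw [hsum] at hx' ⊢
      linear_combination (-4 * p.coeff 2) * hx'
    rw [hdisc]
    have : p.coeff 2 * (x - y) ≠ 0 := mul_ne_zero h2 (sub_ne_zero.2 hxy)
    positivity

end IsRealSimpleForm

/-- For a polynomial of degree exactly `m`, the notion agrees with that of having only real and
simple zeros. -/
lemma hasOnlyRealSimpleZeros_iff {p : ℝ[X]} (hp : p ≠ 0) :
    HasOnlyRealSimpleZeros p ↔ IsRealSimpleForm p.natDegree p := by
  rw [isRealSimpleForm_natDegree_iff hp]
  have hinj : Function.Injective (algebraMap ℝ ℂ) := (algebraMap ℝ ℂ).injective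
  have hpC : p.map (algebraMap ℝ ℂ) ≠ 0 := (Polynomial.map_ne_zero_iff hinj).2 hp
  have hcard : (p.map (algebraMap ℝ ℂ)).roots.card = p.natDegree := by
    rw [← (IsAlgClosed.splits _).natDegree_eq_card_roots, natDegree_map]
  constructor
  · intro h
    have hnodup : (p.map (algebraMap ℝ ℂ)).roots.Nodup := by
      refine Multiset.nodup_iff_count_le_one.2 fun z => ?_
      rw [count_roots]
      by_cases hz : (p.map (algebraMap ℝ ℂ)).IsRoot z
      · exact (h z hz).2.le
      · rw [rootMultiplicity_eq_zero hz]
        exact zero_le_one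
    rw [← hcard, ← Multiset.toFinset_card_of_nodup hnodup]
    refine (Finset.card_le_card fun z hz => ?_).trans
      (Finset.card_image_le (f := algebraMap ℝ ℂ) (s := p.roots.toFinset))
    rw [Multiset.mem_toFinset, mem_roots hpC] at hz
    have hre : algebraMap ℝ ℂ z.re = z := Complex.ext rfl (h z hz).1.symm
    refine Finset.mem_image.2 ⟨z.re, ?_, hre⟩
    rw [Multiset.mem_toFinset, mem_roots hp]
    rw [← hre] at hz
    exact hz.of_map hinj
  · intro h z hz
    have hle := card_roots' p
    have hle' := Multiset.toFinset_card_le p.roots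
    have hnodup : p.roots.Nodup := by
      rw [← Multiset.dedup_eq_self]
      exact Multiset.eq_of_le_of_card_le (Multiset.dedup_le _) (hle.trans h)
    have hroots : (p.map (algebraMap ℝ ℂ)).roots = p.roots.map (algebraMap ℝ ℂ) := by
      refine (Multiset.eq_of_le_of_card_le (map_roots_le hpC) ?_).symm
      rw [Multiset.card_map, hcard]
      omega
    have hmem : z ∈ (p.map (algebraMap ℝ ℂ)).roots := (mem_roots hpC).2 hz
    rw [← count_roots]
    refine ⟨?_, Multiset.count_eq_one_of_mem ?_ hmem⟩
    · rw [hroots, Multiset.mem_map] at hmem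
      obtain ⟨x, -, rfl⟩ := hmem
      exact Complex.ofReal_im x
    · rw [hroots]
      exact hnodup.map hinj

/-! ### Polynomial solutions of the hypergeometric equation -/

/-- The coefficients of `p` satisfy the recursion of the hypergeometric series with parameters
`-ν, b; c`. Equivalently, `p` solves the hypergeometric differential equation
(`isHypergeometricSolution_iff`). -/
def IsHypergeometricSolution (ν b c : ℝ) (p : ℝ[X]) : Prop :=
  ∀ k : ℕ, (k + 1) * (c + k) * p.coeff (k + 1) = (k - ν) * (k + b) * p.coeff k

lemma isHypergeometricSolution_iff {ν b c : ℝ} {p : ℝ[X]} :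
    IsHypergeometricSolution ν b c p ↔
      X * (1 - X) * derivative (derivative p) + (C c - C (b + 1 - ν) * X) * derivative p +
        C (ν * b) * p = 0 := by
  have hexp : X * (1 - X) * derivative (derivative p) +
      (C c - C (b + 1 - ν) * X) * derivative p + C (ν * b) * p =
      X * derivative (derivative p) - X * (X * derivative (derivative p)) + C c * derivative p -
        C (b + 1 - ν) * (X * derivative p) + C (ν * b) * p := by ring
  have hcoeff : ∀ k : ℕ, (X * derivative (derivative p) - X * (X * derivative (derivative p)) +
      C c * derivative p - C (b + 1 - ν) * (X * derivative p) + C (ν * b) * p).coeff k =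
      (k + 1) * (c + k) * p.coeff (k + 1) - (k - ν) * (k + b) * p.coeff k := by
    intro k
    simp only [coeff_add, coeff_sub, coeff_C_mul]
    match k with
    | 0 =>
      simp only [mul_coeff_zero, coeff_X_zero, coeff_derivative]
      push_cast
      ring
    | 1 =>
      simp only [coeff_X_mul, mul_coeff_zero, coeff_X_zero, coeff_derivative]
      push_cast
      ring
    | k + 2 =>
      simp only [coeff_X_mul, coeff_derivative]
      push_cast
      ring
  rw [hexp, Polynomial.ext_iff]
  simp only [hcoeff, coeff_zero, sub_eq_zero, IsHypergeometricSolution]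

namespace IsHypergeometricSolution

variable {ν b c : ℝ} {p : ℝ[X]}

lemma eval_eq_zero (h : IsHypergeometricSolution ν b c p) (x : ℝ) :
    x * (1 - x) * (derivative (derivative p)).eval x +
      (c - (b + 1 - ν) * x) * (derivative p).eval x + ν * b * p.eval x = 0 := by
  simpa using congrArg (eval x) (isHypergeometricSolution_iff.1 h)

lemma derivative (h : IsHypergeometricSolution ν b c p) :
    IsHypergeometricSolution (ν - 1) (b + 1) (c + 1) (derivative p) := by
  intro k
  have := h (k + 1)
  rw [coeff_derivative, coeff_derivative]
  push_cast at this ⊢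
  linear_combination (k + 1 : ℝ) * this

lemma polar_zero (h : IsHypergeometricSolution ν b c p) :
    IsHypergeometricSolution (ν - 1) b c (C ν * p - X * Polynomial.derivative p) := by
  intro k
  have := h k
  simp only [coeff_sub, coeff_C_mul, coeff_X_mul_derivative]
  push_cast
  linear_combination (ν - k - 1) * this

lemma polar_one (h : IsHypergeometricSolution ν b c p) :
    IsHypergeometricSolution (ν - 1) b (c + 1)
      (C ν * p + (1 - X) * Polynomial.derivative p) := by
  intro k
  have h0 := h k
  have h1 := h (k + 1)
  simp only [coeff_add, sub_mul, one_mul, coeff_sub, coeff_C_mul, coeff_X_mul_derivative,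
    coeff_derivative]
  push_cast at h1 ⊢
  linear_combination (k + 1 : ℝ) * h1 - (k + 1 - ν) * h0

lemma reflect {n : ℕ} (h : IsHypergeometricSolution n b c p) (hdeg : p.natDegree ≤ n) :
    IsHypergeometricSolution n (1 - c - n) (1 - b - n) (reflect n p) := by
  intro k
  rw [coeff_reflect, coeff_reflect]
  rcases lt_trichotomy k n with hk | rfl | hk
  · obtain ⟨j, rfl⟩ := Nat.exists_eq_add_of_lt hk
    have := h j
    rw [revAt_le (by omega), revAt_le (by omega), show k + j + 1 - (k + 1) = j by omega,
      show k + j + 1 - k = j + 1 by omega]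
    push_cast at this ⊢
    linear_combination -this
  · rw [revAt_eq_self_of_lt (Nat.lt_succ_self _),
      coeff_eq_zero_of_natDegree_lt (Nat.lt_succ_of_le hdeg)]
    ring
  · rw [revAt_eq_self_of_lt hk, revAt_eq_self_of_lt (by omega),
      coeff_eq_zero_of_natDegree_lt (by omega), coeff_eq_zero_of_natDegree_lt (by omega)]
    ring

/-- The substitution `x ↦ 1 - x` exchanges the singular points `0` and `1`. -/
lemma comp_one_sub (h : IsHypergeometricSolution ν b c p) :
    IsHypergeometricSolution ν b (b + 1 - ν - c) (p.comp (1 - X)) := by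
  rw [isHypergeometricSolution_iff] at h ⊢
  have := congrArg (fun q => q.comp (1 - X)) h
  simp only [add_comp, mul_comp, sub_comp, one_comp, X_comp, C_comp, zero_comp] at this
  simp only [derivative_comp, derivative_mul, derivative_sub, derivative_one, derivative_X,
    derivative_zero]
  simp only [C_sub, C_add, C_mul, C_1, zero_sub] at this ⊢
  linear_combination this

lemma eq_zero_of_coeff_zero_eq_zero {n : ℕ} (h : IsHypergeometricSolution n b c p)
    (hdeg : p.natDegree ≤ n) (hc : ∀ k < n, c + k ≠ 0) (h0 : p.coeff 0 = 0) : p = 0 := by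
  have hle : ∀ k ≤ n, p.coeff k = 0 := by
    intro k
    induction k with
    | zero => exact fun _ => h0
    | succ k ih =>
      intro hk
      have := h k
      rw [ih (by omega), mul_zero] at this
      exact (mul_eq_zero.1 this).resolve_left (mul_ne_zero (by positivity) (hc k (by omega)))
  refine Polynomial.ext fun k => ?_
  rcases le_or_gt k n with hk | hk
  · exact hle k hk
  · exact coeff_eq_zero_of_natDegree_lt (hdeg.trans_lt hk)

end IsHypergeometricSolution

/-! ### Necessity -/

lemma IsRealSimpleForm.mul_pos_of_quadratic {b c : ℝ} {p : ℝ[X]} (hp : IsRealSimpleForm 2 p)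
    (h : IsHypergeometricSolution 2 b c p) (hc : c ≠ 0) (hc1 : c + 1 ≠ 0) :
    0 < b * (b - c) * (c + 1) := by
  have h0 := h 0
  have h1 := h 1
  have hd := hp.discrim_pos
  norm_num at h0 h1
  have key : (p.coeff 1 ^ 2 - 4 * p.coeff 0 * p.coeff 2) * (c ^ 2 * (c + 1) ^ 2) =
      (2 * p.coeff 0) ^ 2 * (b * (b - c) * (c + 1)) := by
    linear_combination ((c + 1) ^ 2 * (c * p.coeff 1 - 2 * b * p.coeff 0) -
      (-2 * p.coeff 0 * c * (c + 1) * (1 + b))) * h0 - 2 * p.coeff 0 * c ^ 2 * (c + 1) * h1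
  have hpos : 0 < (p.coeff 1 ^ 2 - 4 * p.coeff 0 * p.coeff 2) * (c ^ 2 * (c + 1) ^ 2) := by
    positivity
  rw [key] at hpos
  exact pos_of_mul_pos_right hpos (sq_nonneg _)

/-- Taking `q` derivatives, `r` polar derivatives at `1` and `s` polar derivatives at `0` yields a
quadratic hypergeometric polynomial, whose discriminant is positive. -/
lemma IsRealSimpleForm.mul_pos {b c : ℝ} {n q r s : ℕ} {p : ℝ[X]} (hn : q + r + s + 2 = n)
    (hp : IsRealSimpleForm n p) (h : IsHypergeometricSolution n b c p)
    (hc : ∀ k < n, c + k ≠ 0) :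
    0 < (b + q) * (b - c - r) * (c + q + r + 1) := by
  induction n generalizing q r s b c p with
  | zero => omega
  | succ n ih =>
    have hcast : ((n + 1 : ℕ) : ℝ) = n + 1 := by push_cast; ring
    have hsub : ((n + 1 : ℕ) : ℝ) - 1 = n := by push_cast; ring
    have hcs : ∀ k < n, c + 1 + k ≠ 0 := by
      intro k hk
      have := hc (k + 1) (by omega)
      push_cast at this
      rwa [add_assoc, add_comm 1]
    match q, r, s with
    | q + 1, r, s =>
      have h' := h.derivative
      rw [hsub] at h'
      have := ih (by omega) (hp.derivative (by omega)) h' hcs (q := q) (r := r) (s := s)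
      push_cast
      convert this using 1
      ring
    | 0, r + 1, s =>
      have h' := h.polar_one
      rw [hsub, hcast] at h'
      have := ih (by omega) (hp.polar_one (by omega)) h' hcs (q := 0) (r := r) (s := s)
      push_cast at this ⊢
      convert this using 1
      ring
    | 0, 0, s + 1 =>
      have h' := h.polar_zero
      rw [hsub, hcast] at h'
      exact ih (by omega) (hp.polar_zero (by omega)) h' (fun k hk => hc k (by omega))
        (q := 0) (r := 0) (s := s)
    | 0, 0, 0 =>
      obtain rfl : n = 1 := by omega
      norm_num at h
      have := hp.mul_pos_of_quadratic h (by simpa using hc 0 (by omega))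
        (by simpa using hc 1 (by omega))
      simpa using this

/-! ### Sufficiency -/

/-- A counterpart of Rolle's theorem. Suppose that `p * p'` is negative at `l`, positive at `r`, and
decreasing through every critical point of `p`, all of which lie between `l` and `r`. Then `p * p'`
changes sign, so that `p` has a zero, between any two consecutive elements of the set formed by `l`,
`r` and the critical points. -/
lemma card_roots_derivative_lt_card_roots {p : ℝ[X]} {l r : ℝ} (hlr : l < r)
    (hl : p.eval l * (derivative p).eval l < 0) (hr : 0 < p.eval r * (derivative p).eval r)
    (hmem : ∀ x, (derivative p).eval x = 0 → l < x ∧ x < r)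
    (hcrit : ∀ x, (derivative p).eval x = 0 →
      p.eval x * (derivative (derivative p)).eval x < 0) :
    (derivative p).roots.toFinset.card + 1 ≤
      (p.roots.toFinset.filter fun x => l < x ∧ x < r).card := by
  have hp' : derivative p ≠ 0 := by
    intro h
    rw [h, eval_zero, mul_zero] at hl
    exact lt_irrefl _ hl
  have hp : p ≠ 0 := by
    rintro rfl
    exact hp' derivative_zero
  set g : ℝ[X] := p * derivative p with hg
  have hg_eval : ∀ x, g.eval x = p.eval x * (derivative p).eval x := fun x => eval_mul
  have hg_sign : ∀ x, (derivative p).eval x = 0 →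
      ∀ᶠ y in nhds x, SignType.sign (g.eval y) = SignType.sign (x - y) := by
    intro x hx
    refine eventually_nhdsWithin_sign_eq_of_deriv_neg (f := fun y => g.eval y) ?_ ?_
    · rw [Polynomial.deriv, hg, derivative_mul, eval_add, eval_mul, eval_mul, hx]
      simpa using hcrit x hx
    · rw [hg_eval, hx, mul_zero]
  set t := (derivative p).roots.toFinset with ht
  have ht_mem : ∀ x, x ∈ t ↔ (derivative p).eval x = 0 := by
    intro x
    rw [ht, Multiset.mem_toFinset, mem_roots hp', IsRoot.def]
  have hl_not : l ∉ insert r t := by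
    rw [Finset.mem_insert, ht_mem, not_or]
    exact ⟨hlr.ne, fun h => (hmem l h).1.false⟩
  have hr_not : r ∉ t := by
    rw [ht_mem]
    exact fun h => (hmem r h).2.false
  have hcard : (insert l (insert r t)).card = t.card + 2 := by
    rw [Finset.card_insert_of_notMem hl_not, Finset.card_insert_of_notMem hr_not]
  have hbounds : ∀ x ∈ insert l (insert r t), l ≤ x ∧ x ≤ r := by
    intro x hx
    rw [Finset.mem_insert, Finset.mem_insert, ht_mem] at hx
    rcases hx with rfl | rfl | hx
    · exact ⟨le_rfl, hlr.le⟩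
    · exact ⟨hlr.le, le_rfl⟩
    · exact ⟨(hmem x hx).1.le, (hmem x hx).2.le⟩
  have hinter := Finset.card_le_of_interleaved (s := insert l (insert r t))
    (t := p.roots.toFinset.filter fun x => l < x ∧ x < r) ?_
  · omega
  intro u hu v hv huv hconsec
  have hright : ∃ y, u < y ∧ y < v ∧ g.eval y < 0 := by
    have hev : ∀ᶠ y in nhdsWithin u (Set.Ioi u), g.eval y < 0 := by
      by_cases hu' : (derivative p).eval u = 0
      · filter_upwards [(hg_sign u hu').filter_mono nhdsWithin_le_nhds, self_mem_nhdsWithin]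
          with y hy hyu
        rw [sign_neg (sub_neg.2 (Set.mem_Ioi.1 hyu))] at hy
        exact sign_eq_neg_one_iff.1 hy
      · have : u = l := by
          rw [Finset.mem_insert, Finset.mem_insert, ht_mem] at hu
          rcases hu with rfl | rfl | hu
          · rfl
          · exact absurd huv (hbounds v hv).2.not_gt
          · exact absurd hu hu'
        rw [← this, ← hg_eval] at hl
        exact (g.continuous.continuousAt.eventually_lt_const hl).filter_mono nhdsWithin_le_nhds
    obtain ⟨y, hy, hyuv⟩ := (hev.and (Ioo_mem_nhdsGT huv)).exists
    exact ⟨y, hyuv.1, hyuv.2, hy⟩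
  obtain ⟨y, huy, hyv, hy⟩ := hright
  have hleft : ∃ z, y < z ∧ z < v ∧ 0 < g.eval z := by
    have hev : ∀ᶠ z in nhdsWithin v (Set.Iio v), 0 < g.eval z := by
      by_cases hv' : (derivative p).eval v = 0
      · filter_upwards [(hg_sign v hv').filter_mono nhdsWithin_le_nhds, self_mem_nhdsWithin]
          with z hz hzv
        rw [sign_pos (sub_pos.2 (Set.mem_Iio.1 hzv))] at hz
        exact sign_eq_one_iff.1 hz
      · have : v = r := by
          rw [Finset.mem_insert, Finset.mem_insert, ht_mem] at hv
          rcases hv with rfl | rfl | hv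
          · exact absurd huv (hbounds u hu).1.not_gt
          · rfl
          · exact absurd hv hv'
        rw [← this, ← hg_eval] at hr
        exact (g.continuous.continuousAt.eventually_const_lt hr).filter_mono nhdsWithin_le_nhds
    obtain ⟨z, hz, hzyv⟩ := (hev.and (Ioo_mem_nhdsLT hyv)).exists
    exact ⟨z, hzyv.1, hzyv.2, hz⟩
  obtain ⟨z, hyz, hzv, hz⟩ := hleft
  obtain ⟨w, hw, hw0⟩ := intermediate_value_Ioo hyz.le g.continuous.continuousOn ⟨hy, hz⟩
  have huw : u < w := huy.trans hw.1
  have hwv : w < v := hw.2.trans hzv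
  refine ⟨w, ?_, huw, hwv⟩
  rw [Finset.mem_filter, Multiset.mem_toFinset, mem_roots hp, IsRoot.def]
  refine ⟨?_, (hbounds u hu).1.trans_lt huw, hwv.trans_le (hbounds v hv).2⟩
  have hw0' : p.eval w * (derivative p).eval w = 0 := by rw [← hg_eval]; exact hw0
  refine (mul_eq_zero.1 hw0').resolve_right fun h => ?_
  exact hconsec w (Finset.mem_insert_of_mem (Finset.mem_insert_of_mem ((ht_mem w).2 h)))
    ⟨huw, hwv⟩

/-- A nonzero polynomial with as many distinct real zeros as its degree in a set has all its real
zeros there, and they are simple. -/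
lemma forall_root_of_natDegree_le_card_filter {p : ℝ[X]} {s : ℝ → Prop} [DecidablePred s]
    (h : p.natDegree ≤ (p.roots.toFinset.filter s).card) (hp : p ≠ 0) {x : ℝ}
    (hx : p.eval x = 0) : s x ∧ (derivative p).eval x ≠ 0 := by
  have hle := card_roots' p
  have hle' := Multiset.toFinset_card_le p.roots
  have hfilter : p.roots.toFinset.filter s = p.roots.toFinset :=
    Finset.eq_of_subset_of_card_le (Finset.filter_subset _ _) (by omega)
  have hnodup : p.roots.Nodup := by
    rw [← Multiset.dedup_eq_self]
    refine Multiset.eq_of_le_of_card_le (Multiset.dedup_le _) (hle.trans (h.trans ?_))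
    exact Finset.card_filter_le _ _
  have hmem : x ∈ p.roots := (mem_roots hp).2 hx
  constructor
  · have : x ∈ p.roots.toFinset.filter s := by rwa [hfilter, Multiset.mem_toFinset]
    exact (Finset.mem_filter.1 this).2
  · intro hx'
    have h1 := (one_lt_rootMultiplicity_iff_isRoot hp).2 ⟨hx, hx'⟩
    rw [← count_roots, Multiset.count_eq_one_of_mem hnodup hmem] at h1
    exact lt_irrefl _ h1

/-- At a critical point in `(0, 1)`, the differential equation relates the value to the second
derivative. -/
lemma IsHypergeometricSolution.eval_mul_neg {ν b c : ℝ} {p : ℝ[X]}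
    (h : IsHypergeometricSolution ν b c p) (hν : 0 < ν) (hb : 0 < b) {x : ℝ} (hx0 : 0 < x)
    (hx1 : x < 1) (hx : (Polynomial.derivative p).eval x = 0)
    (hx' : (Polynomial.derivative (Polynomial.derivative p)).eval x ≠ 0) :
    p.eval x * (Polynomial.derivative (Polynomial.derivative p)).eval x < 0 := by
  have := h.eval_eq_zero x
  rw [hx, mul_zero, add_zero] at this
  set w := (Polynomial.derivative (Polynomial.derivative p)).eval x
  have hw : 0 < x * (1 - x) * w ^ 2 :=
    _root_.mul_pos (_root_.mul_pos hx0 (by linarith)) (by positivity)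
  have : ν * b * (p.eval x * w) = -(x * (1 - x) * w ^ 2) := by linear_combination w * this
  have hνb := _root_.mul_pos hν hb
  by_contra! hcon
  linarith [mul_nonneg hνb.le hcon]

/-- In the classical range of parameters, the Jacobi polynomials have all their zeros in `(0, 1)`,
and the zeros are simple. The proof is by induction through the derivative, whose parameters stay in
the range; the differential equation gives the signs of `p * p'` at `0` and `1`. -/
lemma IsHypergeometricSolution.natDegree_le_card_filter {n : ℕ} {b c : ℝ} {p : ℝ[X]}
    (h : IsHypergeometricSolution n b c p) (hdeg : p.natDegree = n) (hc : 0 < c)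
    (hb : c + n - 1 < b) :
    n ≤ (p.roots.toFinset.filter fun x => 0 < x ∧ x < 1).card := by
  induction n generalizing b c p with
  | zero => exact Nat.zero_le _
  | succ n ih =>
    have hp'deg : (Polynomial.derivative p).natDegree = n := by
      rw [natDegree_derivative, hdeg, Nat.add_sub_cancel]
    have hp' : Polynomial.derivative p ≠ 0 := by
      intro h0
      have := Polynomial.derivative_eq_zero.1 h0
      omega
    push_cast at h hb
    have hd := h.derivative
    rw [add_sub_cancel_right] at hd
    have hIH := ih hd hp'deg (by linarith) (by linarith)
    have hroot : ∀ x, (Polynomial.derivative p).eval x = 0 → (0 < x ∧ x < 1) ∧ _ := fun x hx =>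
      forall_root_of_natDegree_le_card_filter (hp'deg.trans_le hIH) hp' hx
    have hn0 : (0 : ℝ) ≤ n := Nat.cast_nonneg n
    have hb0 : 0 < b := by linarith
    have hnb : 0 < ((n : ℝ) + 1) * b := by positivity
    have h0 : (Polynomial.derivative p).eval 0 ≠ 0 := fun h0 => (hroot 0 h0).1.1.false
    have h1 : (Polynomial.derivative p).eval 1 ≠ 0 := fun h1 => (hroot 1 h1).1.2.false
    have e0 := h.eval_eq_zero 0
    have e1 := h.eval_eq_zero 1
    have hcount := card_roots_derivative_lt_card_roots (p := p) zero_lt_one ?_ ?_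
      (fun x hx => (hroot x hx).1)
      (fun x hx => h.eval_mul_neg (by positivity) hb0 (hroot x hx).1.1 (hroot x hx).1.2 hx
        (hroot x hx).2)
    · have := Finset.card_filter_le (Polynomial.derivative p).roots.toFinset
        (fun x => 0 < x ∧ x < 1)
      omega
    · have hsq : 0 < c * ((Polynomial.derivative p).eval 0) ^ 2 := by positivity
      by_contra! hcon
      have := mul_nonneg hnb.le hcon
      have : (n + 1) * b * (p.eval 0 * (Polynomial.derivative p).eval 0) =
        -(c * ((Polynomial.derivative p).eval 0) ^ 2) := by
        linear_combination (Polynomial.derivative p).eval 0 * e0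
      linarith
    · have hsq : 0 < (b - c - n) * ((Polynomial.derivative p).eval 1) ^ 2 :=
        _root_.mul_pos (by linarith) (by positivity)
      by_contra! hcon
      have := mul_nonneg hnb.le (neg_nonneg.2 hcon)
      have : (n + 1) * b * (p.eval 1 * (Polynomial.derivative p).eval 1) =
        (b - c - n) * ((Polynomial.derivative p).eval 1) ^ 2 := by
        linear_combination (Polynomial.derivative p).eval 1 * e1
      linarith

lemma exists_gt_eval_mul_derivative_pos {p : ℝ[X]} (hp : 0 < p.natDegree) (M : ℝ) :
    ∃ x, M < x ∧ 0 < p.eval x * (derivative p).eval x := by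
  have hp0 : p ≠ 0 := ne_zero_of_natDegree_gt hp
  have hp' : derivative p ≠ 0 := by
    rw [Ne, Polynomial.derivative_eq_zero]
    exact hp.ne'
  have hdeg : 0 < (p * derivative p).degree := by
    rw [← natDegree_pos_iff_degree_pos, natDegree_mul hp0 hp']
    omega
  have hlead : 0 ≤ (p * derivative p).leadingCoeff := by
    rw [leadingCoeff_mul, leadingCoeff, leadingCoeff, natDegree_derivative, coeff_derivative,
      Nat.sub_add_cancel hp, ← mul_assoc]
    exact mul_nonneg (mul_self_nonneg _) (by positivity)
  obtain ⟨x, hx, hMx⟩ := (((p * derivative p).tendsto_atTop_of_leadingCoeff_nonneg hdeg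
    hlead).eventually_gt_atTop 0 |>.and (Filter.eventually_gt_atTop M)).exists
  exact ⟨x, hMx, by rwa [eval_mul] at hx⟩

lemma exists_lt_eval_mul_derivative_neg {p : ℝ[X]} (hp : 0 < p.natDegree) (M : ℝ) :
    ∃ x, x < M ∧ p.eval x * (derivative p).eval x < 0 := by
  have hdeg : 0 < (p.comp (-X)).natDegree := by
    rwa [natDegree_comp, natDegree_neg, natDegree_X, mul_one]
  obtain ⟨x, hx, hpos⟩ := exists_gt_eval_mul_derivative_pos hdeg (-M)
  refine ⟨-x, by linarith, ?_⟩
  simp only [derivative_comp, eval_comp, eval_mul, eval_neg, eval_X, derivative_neg,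
    derivative_X, eval_one] at hpos
  linarith

namespace IsHypergeometricSolution

variable {n : ℕ} {b c : ℝ} {p : ℝ[X]}

/-- When the exponent parameters at `0` and `1` exceed `-2`, the derivative belongs to the
classical range, so its zeros lie in `(0, 1)`, whereas the outermost zeros of `p` itself may leave
that interval. The bound `3 ≤ n` ensures `0 < b`. -/
lemma isRealSimpleForm (h : IsHypergeometricSolution n b c p) (hdeg : p.natDegree = n)
    (hn : 3 ≤ n) (hc : -1 < c) (hb : c + n - 2 < b) : IsRealSimpleForm n p := by
  obtain ⟨m, rfl⟩ : ∃ m, n = m + 1 := ⟨n - 1, by omega⟩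
  have hm : (2 : ℝ) ≤ m := by exact_mod_cast (by omega : 2 ≤ m)
  have hp : p ≠ 0 := ne_zero_of_natDegree_gt (n := 0) (by omega)
  have hp'deg : (Polynomial.derivative p).natDegree = m := by
    rw [natDegree_derivative, hdeg, Nat.add_sub_cancel]
  have hp' : Polynomial.derivative p ≠ 0 := ne_zero_of_natDegree_gt (n := 0) (by omega)
  push_cast at h hb
  have hd := h.derivative
  rw [add_sub_cancel_right] at hd
  have hcard := hd.natDegree_le_card_filter hp'deg (by linarith) (by linarith)
  have hroot : ∀ x, (Polynomial.derivative p).eval x = 0 → (0 < x ∧ x < 1) ∧ _ := fun x hx =>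
    forall_root_of_natDegree_le_card_filter (hp'deg.trans_le hcard) hp' hx
  obtain ⟨l, hl0, hl⟩ := exists_lt_eval_mul_derivative_neg (by omega : 0 < p.natDegree) 0
  obtain ⟨r, hr1, hr⟩ := exists_gt_eval_mul_derivative_pos (by omega : 0 < p.natDegree) 1
  have hcount := card_roots_derivative_lt_card_roots (p := p) (by linarith) hl hr
    (fun x hx => ⟨hl0.trans (hroot x hx).1.1, (hroot x hx).1.2.trans hr1⟩)
    (fun x hx => h.eval_mul_neg (by positivity) (by linarith) (hroot x hx).1.1
      (hroot x hx).1.2 hx (hroot x hx).2)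
  have h1 := Finset.card_filter_le (Polynomial.derivative p).roots.toFinset
    (fun x => 0 < x ∧ x < 1)
  have h2 := Finset.card_filter_le p.roots.toFinset (fun x => l < x ∧ x < r)
  rw [← hdeg, isRealSimpleForm_natDegree_iff hp]
  omega

/-- The substitution `x ↦ 1 / x` exchanges the singular points `0` and `∞`. -/
lemma isRealSimpleForm_of_one_infty (h : IsHypergeometricSolution n b c p)
    (hdeg : p.natDegree ≤ n) (h0 : p.coeff 0 ≠ 0) (hn : 3 ≤ n) (hb : b < 2 - n)
    (hbc : c + n - 2 < b) : IsRealSimpleForm n p := by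
  have hdeg' : (Polynomial.reflect n p).natDegree = n := by
    refine natDegree_eq_of_le_of_coeff_ne_zero (natDegree_reflect_le.trans (by omega)) ?_
    rwa [coeff_reflect, revAt_le le_rfl, Nat.sub_self]
  have := ((h.reflect hdeg).isRealSimpleForm hdeg' hn (by linarith) (by linarith)).reflect
  rwa [reflect_reflect] at this

/-- The substitution `x ↦ 1 - x` exchanges the singular points `0` and `1`. -/
lemma isRealSimpleForm_of_zero_infty (h : IsHypergeometricSolution n b c p)
    (hdeg : p.natDegree ≤ n) (hp : p ≠ 0) (hn : 3 ≤ n) (hb : b < 2 - n) (hc : -1 < c) :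
    IsRealSimpleForm n p := by
  have hcomp : (p.comp (1 - X)).comp (1 - X) = p := by
    rw [comp_assoc]
    simp
  have hn' : (3 : ℝ) ≤ n := by exact_mod_cast hn
  have hdeg' : (p.comp (1 - X)).natDegree ≤ n := by
    refine natDegree_comp_le.trans ?_
    have : (1 - X : ℝ[X]).natDegree ≤ 1 := by compute_degree
    calc p.natDegree * (1 - X : ℝ[X]).natDegree ≤ n * 1 := Nat.mul_le_mul hdeg this
      _ = n := mul_one n
  have h0 : (p.comp (1 - X)).coeff 0 ≠ 0 := by
    intro h0
    refine hp ?_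
    rw [← hcomp, h.comp_one_sub.eq_zero_of_coeff_zero_eq_zero hdeg' ?_ h0, zero_comp]
    intro k hk
    have : (k : ℝ) + 1 ≤ n := by exact_mod_cast hk
    exact (by linarith : b + 1 - n - c + k < 0).ne
  have := (h.comp_one_sub.isRealSimpleForm_of_one_infty hdeg' h0 hn hb
    (by linarith)).comp_affine (neg_ne_zero.2 one_ne_zero) 1
  rwa [show (C (-1) * X + C 1 : ℝ[X]) = 1 - X by simp; ring, hcomp] at this

end IsHypergeometricSolution

/-! ### The hypergeometric polynomial -/

lemma coeff_hypergeometricPolynomial (n : ℕ) (b c : ℝ) (k : ℕ) :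
    (hypergeometricPolynomial n b c).coeff k =
      if k < n + 1 then ordinaryHypergeometricCoefficient (-(n : ℝ)) b c k else 0 := by
  simp only [hypergeometricPolynomial, finsetSum_coeff, coeff_C_mul, coeff_X_pow, mul_ite, mul_one,
    mul_zero, Finset.sum_ite_eq, Finset.mem_range]

lemma isHypergeometricSolution_hypergeometricPolynomial {n : ℕ} {b c : ℝ}
    (hc : ∀ k < n, c + k ≠ 0) :
    IsHypergeometricSolution n b c (hypergeometricPolynomial n b c) := by
  intro k
  rw [coeff_hypergeometricPolynomial, coeff_hypergeometricPolynomial]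
  rcases lt_trichotomy k n with hk | rfl | hk
  · rw [if_pos (by omega), if_pos (by omega), ordinaryHypergeometricCoefficient,
      ordinaryHypergeometricCoefficient]
    have hck := hc k hk
    have hk1 : (k : ℝ) + 1 ≠ 0 := by positivity
    rw [Nat.factorial_succ, Nat.cast_mul, Nat.cast_succ]
    simp only [ascPochhammer_succ_eval, mul_inv]
    field_simp
    ring
  · simp
  · rw [if_neg (by omega), if_neg (by omega), mul_zero, mul_zero]

lemma coeff_zero_hypergeometricPolynomial (n : ℕ) (b c : ℝ) :
    (hypergeometricPolynomial n b c).coeff 0 = 1 := by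
  simp [coeff_hypergeometricPolynomial, ordinaryHypergeometricCoefficient]

lemma natDegree_hypergeometricPolynomial {n : ℕ} {b c : ℝ} (hb : ∀ k < n, b + k ≠ 0)
    (hc : ∀ k < n, c + k ≠ 0) : (hypergeometricPolynomial n b c).natDegree = n := by
  have hne : ∀ k ≤ n, (hypergeometricPolynomial n b c).coeff k ≠ 0 := by
    intro k
    induction k with
    | zero => simp [coeff_zero_hypergeometricPolynomial]
    | succ k ih =>
      intro hk h0
      have := isHypergeometricSolution_hypergeometricPolynomial (b := b) hc k
      rw [h0, mul_zero] at this
      have hkn : (k : ℝ) - n ≠ 0 := sub_ne_zero.2 (by exact_mod_cast (by omega : k ≠ n))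
      have hbk : (k : ℝ) + b ≠ 0 := by
        rw [add_comm]
        exact hb k (by omega)
      exact mul_ne_zero (mul_ne_zero hkn hbk) (ih (by omega)) this.symm
  refine natDegree_eq_of_le_of_coeff_ne_zero ?_ (hne n le_rfl)
  refine natDegree_le_iff_coeff_eq_zero.2 fun k hk => ?_
  rw [coeff_hypergeometricPolynomial, if_neg (by omega)]

/-- In terms of the exponent parameters `α = c - 1`, `β = b - c - n`, `γ = -b - n` at the singular
points, whose sum is `-2 n - 1`, the region says that two of them exceed `-2`. -/
lemma mem_regions_iff (n : ℕ) (b c : ℝ) :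
    (c, b) ∈ regionR₁ n ∪ regionR₂ n ∪ regionR₃ n ∪ regionR₄ n ↔
      (-1 < c ∧ c + n - 2 < b) ∨ (-1 < c ∧ b < 2 - n) ∨ (c + n - 2 < b ∧ b < 2 - n) := by
  simp only [regionR₁, regionR₂, regionR₃, regionR₄, Set.mem_union, Set.mem_ofPred_eq]
  constructor
  · rintro (((⟨h1, h2⟩ | ⟨h1, h2⟩) | ⟨h1, -, h2⟩) | ⟨h1, -, h2, -⟩)
    · exact Or.inr (Or.inr ⟨h1, h2⟩)
    · exact Or.inr (Or.inl ⟨h1, h2⟩)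
    · exact Or.inl ⟨h1, h2⟩
    · exact Or.inl ⟨h1, h2⟩
  · rintro (⟨h1, h2⟩ | ⟨h1, h2⟩ | ⟨h1, h2⟩)
    · rcases lt_or_ge ((n : ℝ) - 2) b with h | h
      · exact Or.inl (Or.inr ⟨h1, h, h2⟩)
      · exact Or.inr ⟨h1, by linarith, h2, h⟩
    · exact Or.inl (Or.inl (Or.inr ⟨h1, h2⟩))
    · exact Or.inl (Or.inl (Or.inl ⟨h1, h2⟩))

theorem theorem3p2 (n : ℕ) (hn : 4 ≤ n) (b c : ℝ)
    (hb : ∀ k : ℕ, k < n → b ≠ -(k : ℝ)) (hc : ∀ k : ℕ, k < n → c ≠ -(k : ℝ)) :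
    HasOnlyRealSimpleZeros (hypergeometricPolynomial n b c) ↔
      (c, b) ∈ regionR₁ n ∪ regionR₂ n ∪ regionR₃ n ∪ regionR₄ n := by
  have hb' : ∀ k < n, b + k ≠ 0 := fun k hk h => hb k hk (eq_neg_of_add_eq_zero_left h)
  have hc' : ∀ k < n, c + k ≠ 0 := fun k hk h => hc k hk (eq_neg_of_add_eq_zero_left h)
  have hsol := isHypergeometricSolution_hypergeometricPolynomial (b := b) hc'
  have hdeg := natDegree_hypergeometricPolynomial hb' hc'
  have h0 : (hypergeometricPolynomial n b c).coeff 0 ≠ 0 := by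
    rw [coeff_zero_hypergeometricPolynomial]
    exact one_ne_zero
  have hp : hypergeometricPolynomial n b c ≠ 0 := by
    intro h
    rw [h, coeff_zero] at h0
    exact h0 rfl
  rw [hasOnlyRealSimpleZeros_iff hp, hdeg, mem_regions_iff]
  constructor
  · intro h
    have key := two_gt_of_forall_mul_neg hn (A := c + n - 1) (B := b - c) (G := -b) (by ring) ?_
    · rcases key with ⟨h1, h2⟩ | ⟨h1, h2⟩ | ⟨h1, h2⟩
      · exact Or.inl ⟨by linarith, by linarith⟩
      · exact Or.inr (Or.inl ⟨by linarith, by linarith⟩)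
      · exact Or.inr (Or.inr ⟨by linarith, by linarith⟩)
    · intro s r q hsum
      have hpos := h.mul_pos (q := q) (r := r) (s := s) (by omega) hsol hc'
      have hcast : (n : ℝ) = s + r + q + 2 := by exact_mod_cast (by omega : n = s + r + q + 2)
      rw [hcast]
      linarith
  · rintro (⟨h1, h2⟩ | ⟨h1, h2⟩ | ⟨h1, h2⟩)
    · exact hsol.isRealSimpleForm hdeg (by omega) h1 h2
    · exact hsol.isRealSimpleForm_of_zero_infty hdeg.le hp (by omega) h2 h1
    · exact hsol.isRealSimpleForm_of_one_infty hdeg.le h0 (by omega) h2 h1
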